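/- Let $a_n>0$ and $b_n\in\mathbb R$ ($n=0,1,2,\dots$) be bounded sequences and let $J$ be the bounded self-adjoint Jacobi operator in $\ell^2(\mathbb Z_+)$ given by $(Ju)_0=b_0u_0+a_0u_1$ and $(Ju)_n=a_{n-1}u_{n-1}+b_nu_n+a_nu_{n+1}$ for $n\ge 1$. Let $E(\lambda)$ be the spectral family of $J$, let $e_0=(1,0,0,\dots)$, and let $d\rho(\lambda)=d(E(\lambda)e_0,e_0)$ be the spectral measure of $J$. Suppose that $$\lim_{n\to\infty}\Big(a_n-\frac12\Big)=\lim_{n\to\infty}b_n=0\qquad\text{and}\qquad \sum_{n=0}^\infty\big(|a_{n+1}-a_n|+|b_{n+1}-b_n|\big)<\infty .$$ Then $\rho$ is absolutely continuous on $(-1,1)$, that is, $d\rho(\lambda)=w(\lambda)\,d\lambda$ for $\lambda\in(-1,1)$, with a weight $w$ that is a continuous, strictly positive function on $(-1,1)$. -/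

import Mathlib

open Filter Topology MeasureTheory Set
open scoped InnerProductSpace

/-! ## The Jacobi operator in `ℓ²(ℤ₊)` -/

/-- The Hilbert space `ℓ²(ℤ₊)` of square summable complex sequences. -/
abbrev EllTwo : Type := lp (fun _ : ℕ => ℂ) 2

/-- Formal action of the Jacobi matrix with diagonal `b` and off-diagonal `a` on a sequence:
`(J u)₀ = b₀ u₀ + a₀ u₁` and `(J u)ₙ = aₙ₋₁ uₙ₋₁ + bₙ uₙ + aₙ uₙ₊₁` for `n ≥ 1`. -/
def jacobiSeq (a b : ℕ → ℝ) (u : ℕ → ℂ) : ℕ → ℂ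
  | 0 => b 0 * u 0 + a 0 * u 1
  | n + 1 => a n * u n + b (n + 1) * u (n + 1) + a (n + 1) * u (n + 2)

theorem memlp_two_iff (u : ℕ → ℂ) : Memℓp u 2 ↔ Summable fun n => ‖u n‖ ^ 2 := by
  have := memℓp_gen_iff (E := fun _ : ℕ => ℂ) (p := 2) (f := u) (by norm_num)
  simpa using this

theorem memlp_jacobiSeq {a b : ℕ → ℝ} (ha : ∃ C, ∀ n, |a n| ≤ C) (hb : ∃ C, ∀ n, |b n| ≤ C)
    (u : EllTwo) : Memℓp (jacobiSeq a b u) 2 := by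
  obtain ⟨A, hA⟩ := ha
  obtain ⟨B, hB⟩ := hb
  have key : ∀ (c : ℕ → ℝ) (C : ℝ) (v : ℕ → ℂ), (∀ n, |c n| ≤ C) → Memℓp v 2 →
      Memℓp (fun n => (c n : ℂ) * v n) 2 := by
    intro c C v hc hv
    rw [memlp_two_iff] at hv ⊢
    refine Summable.of_nonneg_of_le (fun _ => by positivity) (fun n => ?_) (hv.mul_left (C ^ 2))
    rw [norm_mul, mul_pow, Complex.norm_real, Real.norm_eq_abs]
    have := hc n
    gcongr
  have hu : Memℓp (u : ℕ → ℂ) 2 := lp.memℓp u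
  have hu1 : Memℓp (fun n => u (n + 1)) 2 := by
    rw [memlp_two_iff] at hu ⊢
    exact (summable_nat_add_iff 1).2 hu
  have h1 := key b B u hB hu
  have h2 := key a A _ hA hu1
  have h3 : Memℓp (fun n => Nat.casesOn n 0 (fun k => (a k : ℂ) * u k) : ℕ → ℂ) 2 := by
    have := key a A u hA hu
    rw [memlp_two_iff] at this ⊢
    exact (summable_nat_add_iff 1).1 this
  convert (h3.add h1).add h2 using 1
  funext n
  cases n <;> simp [jacobiSeq]

/-- The Jacobi operator as a linear map. -/
def jacobiLinear (a b : ℕ → ℝ) (ha : ∃ C, ∀ n, |a n| ≤ C) (hb : ∃ C, ∀ n, |b n| ≤ C) :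
    EllTwo →ₗ[ℂ] EllTwo where
  toFun u := ⟨jacobiSeq a b u, memlp_jacobiSeq ha hb u⟩
  map_add' u v := by
    ext n
    change jacobiSeq a b (⇑u + ⇑v) n = jacobiSeq a b u n + jacobiSeq a b v n
    cases n <;> simp only [jacobiSeq, Pi.add_apply] <;> ring
  map_smul' c u := by
    ext n
    change jacobiSeq a b (c • ⇑u) n = c * jacobiSeq a b u n
    cases n <;> simp only [jacobiSeq, Pi.smul_apply, smul_eq_mul] <;> ring

theorem lp_coord_tendsto {ι : Type*} {l : Filter ι} {u : ι → EllTwo} {x : EllTwo}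
    (h : Tendsto u l (𝓝 x)) (n : ℕ) : Tendsto (fun k => u k n) l (𝓝 (x n)) := by
  rw [tendsto_iff_norm_sub_tendsto_zero] at h ⊢
  refine squeeze_zero (fun _ => norm_nonneg _) (fun k => ?_) h
  simpa using lp.norm_apply_le_norm (p := 2) (by norm_num) (u k - x) n

/-- The bounded Jacobi operator `J` in `ℓ²(ℤ₊)` defined by bounded sequences `a`, `b`. (Its
continuity is obtained from the closed graph theorem.) -/
noncomputable def jacobiOperator (a b : ℕ → ℝ) (ha : ∃ C, ∀ n, |a n| ≤ C)
    (hb : ∃ C, ∀ n, |b n| ≤ C) : EllTwo →L[ℂ] EllTwo :=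
  ContinuousLinearMap.ofSeqClosedGraph (g := jacobiLinear a b ha hb) (by
    intro u x y hu hy
    ext n
    refine tendsto_nhds_unique (lp_coord_tendsto hy n) ?_
    have h := lp_coord_tendsto hu
    cases n with
    | zero => exact ((h 0).const_mul _).add ((h 1).const_mul _)
    | succ n =>
      exact (((h n).const_mul _).add ((h (n + 1)).const_mul _)).add ((h (n + 2)).const_mul _))

theorem jacobiOperator_apply (a b : ℕ → ℝ) (ha : ∃ C, ∀ n, |a n| ≤ C)
    (hb : ∃ C, ∀ n, |b n| ≤ C) (u : EllTwo) (n : ℕ) :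
    jacobiOperator a b ha hb u n = jacobiSeq a b u n := rfl

/-- The canonical basis vector `eₙ` of `ℓ²(ℤ₊)`. -/
noncomputable def basisVec (n : ℕ) : EllTwo := lp.single 2 n (1 : ℂ)

theorem inner_basisVec (n : ℕ) (u : EllTwo) : ⟪basisVec n, u⟫_ℂ = u n := by
  rw [basisVec, lp.inner_single_left]
  simp

theorem basisVec_apply (n k : ℕ) : basisVec n k = if k = n then 1 else 0 := by
  simp [basisVec, Pi.single_apply]

theorem jacobiOperator_basisVec_zero (a b : ℕ → ℝ) (ha : ∃ C, ∀ n, |a n| ≤ C)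
    (hb : ∃ C, ∀ n, |b n| ≤ C) : jacobiOperator a b ha hb (basisVec 0) =
      (b 0 : ℂ) • basisVec 0 + (a 0 : ℂ) • basisVec 1 := by
  ext j
  rw [jacobiOperator_apply, lp.coeFn_add, Pi.add_apply, lp.coeFn_smul, lp.coeFn_smul,
    Pi.smul_apply, Pi.smul_apply]
  rcases j with _ | _ | j <;> simp [jacobiSeq, basisVec_apply]

theorem jacobiOperator_basisVec_succ (a b : ℕ → ℝ) (ha : ∃ C, ∀ n, |a n| ≤ C)
    (hb : ∃ C, ∀ n, |b n| ≤ C) (n : ℕ) : jacobiOperator a b ha hb (basisVec (n + 1)) =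
      (a n : ℂ) • basisVec n + (b (n + 1) : ℂ) • basisVec (n + 1) +
        (a (n + 1) : ℂ) • basisVec (n + 2) := by
  ext j
  rw [jacobiOperator_apply, lp.coeFn_add, Pi.add_apply, lp.coeFn_add, Pi.add_apply,
    lp.coeFn_smul, lp.coeFn_smul, lp.coeFn_smul, Pi.smul_apply, Pi.smul_apply, Pi.smul_apply]
  simp only [smul_eq_mul]
  rcases j with _ | j
  · rcases n with _ | n <;> simp [jacobiSeq, basisVec_apply]
  · simp only [jacobiSeq, basisVec_apply]
    by_cases h1 : j = n + 1
    · subst h1; simp; try omega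
    by_cases h2 : j = n
    · subst h2; simp
    by_cases h3 : j + 1 = n
    · subst h3; simp; try omega
    simp [h1, h2, h3]

theorem jacobiOperator_isSelfAdjoint (a b : ℕ → ℝ) (ha : ∃ C, ∀ n, |a n| ≤ C)
    (hb : ∃ C, ∀ n, |b n| ≤ C) : IsSelfAdjoint (jacobiOperator a b ha hb) := by
  rw [ContinuousLinearMap.isSelfAdjoint_iff']
  ext u n
  rw [← inner_basisVec n (ContinuousLinearMap.adjoint _ u), ContinuousLinearMap.adjoint_inner_right]
  cases n with
  | zero =>
    rw [jacobiOperator_basisVec_zero, jacobiOperator_apply]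
    simp only [inner_add_left, inner_smul_left, inner_basisVec, jacobiSeq, Complex.conj_ofReal]
  | succ n =>
    rw [jacobiOperator_basisVec_succ, jacobiOperator_apply]
    simp only [inner_add_left, inner_smul_left, inner_basisVec, jacobiSeq, Complex.conj_ofReal]

/-! ## The spectral family and the spectral measures of a bounded self-adjoint operator -/

section Spectral

variable {H : Type*} [NormedAddCommGroup H] [InnerProductSpace ℂ H] [CompleteSpace H]

/-- The spectral family `E(lam)` of a bounded self-adjoint operator `A`: the orthogonal projection
onto the kernel of the positive part `(A - lam)₊`, that is, the spectral projection of `A` for the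
half-line `(-∞, lam]`. -/
noncomputable def spectralFamily (A : H →L[ℂ] H) (lam : ℝ) : H →L[ℂ] H :=
  (cfc (fun x : ℝ => max (x - lam) 0) A).ker.starProjection

/-- The function `lam ↦ (E(lam) v, v)`. -/
noncomputable def spectralDistribution (A : H →L[ℂ] H) (v : H) (lam : ℝ) : ℝ :=
  (⟪spectralFamily A lam v, v⟫_ℂ).re

/-- A continuous approximation of the indicator function of `(-∞, lam]`. -/
noncomputable def iicApprox (lam : ℝ) (n : ℕ) (x : ℝ) : ℝ := 1 - min 1 ((n + 1) * max (x - lam) 0)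

theorem continuous_iicApprox (lam : ℝ) (n : ℕ) : Continuous (iicApprox lam n) := by
  unfold iicApprox; fun_prop

theorem iicApprox_mem (lam : ℝ) (n : ℕ) (x : ℝ) :
    0 ≤ iicApprox lam n x ∧ iicApprox lam n x ≤ 1 := by
  unfold iicApprox
  have : 0 ≤ ((n : ℝ) + 1) * max (x - lam) 0 := by positivity
  constructor
  · linarith [min_le_left 1 (((n : ℝ) + 1) * max (x - lam) 0)]
  · linarith [le_min zero_le_one this]

theorem tendsto_iicApprox (lam x : ℝ) :
    Tendsto (fun n => iicApprox lam n x) atTop (𝓝 ((Iic lam).indicator 1 x)) := by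
  by_cases hx : x ≤ lam
  · have : ∀ n, iicApprox lam n x = 1 := by
      intro n
      have : max (x - lam) 0 = 0 := max_eq_right (by linarith)
      simp [iicApprox, this]
    simp [this, hx]
  · push Not at hx
    have h0 : (Iic lam).indicator (1 : ℝ → ℝ) x = 0 := by simp [hx]
    rw [h0]
    refine tendsto_const_nhds.congr' ?_
    have h1 : 0 < x - lam := by linarith
    have := (tendsto_natCast_atTop_atTop (R := ℝ)).atTop_mul_const h1
    filter_upwards [this.eventually_ge_atTop 1] with n hn
    have hn : 1 ≤ ((n : ℝ) + 1) * (x - lam) := by nlinarith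
    rw [iicApprox, max_eq_left h1.le, min_eq_left hn, sub_self]

theorem norm_iicApprox_mul_le (lam : ℝ) (n : ℕ) (x : ℝ) :
    ‖iicApprox lam n x * max (x - lam) 0‖ ≤ 1 / ((n : ℝ) + 1) := by
  have ht : 0 ≤ max (x - lam) 0 := le_max_right _ _
  rw [Real.norm_of_nonneg (mul_nonneg (iicApprox_mem lam n x).1 ht), le_div_iff₀ (by positivity)]
  unfold iicApprox
  generalize max (x - lam) 0 = t at *
  have hn : (0 : ℝ) < (n : ℝ) + 1 := by positivity
  rcases le_total 1 (((n : ℝ) + 1) * t) with h | h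
  · rw [min_eq_left h]; simp
  · rw [min_eq_right h]
    have := mul_nonneg hn.le ht
    nlinarith

theorem tendsto_cfc_iicApprox {A : H →L[ℂ] H} (hA : IsSelfAdjoint A) (lam : ℝ) (v : H) :
    Tendsto (fun n => cfc (iicApprox lam n) A v) atTop (𝓝 (spectralFamily A lam v)) := by
  set T : H →L[ℂ] H := cfc (fun x : ℝ => max (x - lam) 0) A with hT
  have hTsa : IsSelfAdjoint T := cfc_predicate _ A
  have hcont : ∀ n, ContinuousOn (iicApprox lam n) (spectrum ℝ A) :=
    fun n => (continuous_iicApprox lam n).continuousOn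
  have hcT : ContinuousOn (fun x : ℝ => max (x - lam) 0) (spectrum ℝ A) := by fun_prop
  have hnorm : ∀ n, ‖cfc (iicApprox lam n) A‖ ≤ 1 := by
    intro n
    refine norm_cfc_le zero_le_one (fun x _ => ?_)
    have := iicApprox_mem lam n x
    rw [Real.norm_of_nonneg this.1]
    exact this.2
  have hmul : ∀ n, ‖cfc (iicApprox lam n) A * T‖ ≤ 1 / ((n : ℝ) + 1) := by
    intro n
    rw [hT, ← cfc_mul _ _ A (hcont n) hcT]
    exact norm_cfc_le (by positivity) (fun x _ => norm_iicApprox_mul_le lam n x)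
  have hker : ∀ n, ∀ w ∈ T.ker, cfc (iicApprox lam n) A w = w := by
    intro n w hw
    let h : ℝ → ℝ := fun x => ((n : ℝ) + 1) / max 1 (((n : ℝ) + 1) * max (x - lam) 0)
    have hh : Continuous h := by
      refine Continuous.div (by fun_prop) (by fun_prop) (fun x => ?_)
      exact (lt_of_lt_of_le zero_lt_one (le_max_left _ _)).ne'
    have e : iicApprox lam n = fun x => 1 - h x * max (x - lam) 0 := by
      funext x
      simp only [iicApprox, h]
      generalize max (x - lam) 0 = t
      rcases le_total 1 (((n : ℝ) + 1) * t) with h1 | h1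
      · have : t ≠ 0 := by rintro rfl; norm_num at h1
        have : (n : ℝ) + 1 ≠ 0 := by positivity
        rw [min_eq_left h1, max_eq_right h1]; field_simp
      · rw [min_eq_right h1, max_eq_left h1]; simp
    have e2 : cfc (iicApprox lam n) A = 1 - cfc h A * T := by
      rw [e, cfc_sub (fun _ => (1 : ℝ)) (fun x => h x * max (x - lam) 0) A (by fun_prop)
        (hh.continuousOn.mul hcT), cfc_mul _ _ A hh.continuousOn hcT, cfc_const_one ℝ A]
    have hw' : T w = 0 := hw
    rw [e2]
    simp [hw']
  have hperp : ∀ w ∈ T.kerᗮ, Tendsto (fun n => cfc (iicApprox lam n) A w) atTop (𝓝 0) := by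
    intro w hw
    rw [ContinuousLinearMap.orthogonal_ker, hTsa.adjoint_eq] at hw
    rw [Metric.tendsto_atTop]
    intro ε hε
    obtain ⟨y, ⟨u, rfl⟩, hu⟩ := Metric.mem_closure_iff.1 hw (ε / 2) (by positivity)
    have hlim : Tendsto (fun n : ℕ => 1 / ((n : ℝ) + 1) * ‖u‖) atTop (𝓝 0) := by
      simpa using (tendsto_one_div_add_atTop_nhds_zero_nat (𝕜 := ℝ)).mul_const ‖u‖
    obtain ⟨N, hN⟩ := Filter.eventually_atTop.1 (hlim.eventually_lt_const (half_pos hε))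
    refine ⟨N, fun n hn => ?_⟩
    rw [dist_zero_right]
    have h1 : cfc (iicApprox lam n) A w =
        cfc (iicApprox lam n) A (w - T u) + (cfc (iicApprox lam n) A * T) u := by
      simp
    rw [h1]
    have h2 := (cfc (iicApprox lam n) A).le_of_opNorm_le (hnorm n) (w - T u)
    have h3 := (cfc (iicApprox lam n) A * T).le_of_opNorm_le (hmul n) u
    have h4 := hN n hn
    rw [dist_eq_norm] at hu
    have hu : ‖w - T u‖ < ε / 2 := hu
    calc _ ≤ _ := norm_add_le _ _
      _ < ε := by linarith
  have hP : spectralFamily A lam v = T.ker.starProjection v := rfl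
  have hdec : ∀ n, cfc (iicApprox lam n) A v = T.ker.starProjection v +
      cfc (iicApprox lam n) A (v - T.ker.starProjection v) := by
    intro n
    rw [map_sub, hker n _ (Submodule.starProjection_apply_mem _ _)]
    abel
  simp_rw [hdec]
  rw [hP]
  simpa using tendsto_const_nhds.add
    (hperp _ (Submodule.sub_starProjection_mem_orthogonal (K := T.ker) v))

/-- The continuous functional calculus of `A`, in the state given by `v`, is integration with
respect to some finite measure. -/
theorem exists_measure_cfc {A : H →L[ℂ] H} (hA : IsSelfAdjoint A) (v : H) :
    ∃ μ : Measure ℝ, IsFiniteMeasure μ ∧ ∀ f : ℝ → ℝ, Continuous f →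
      Integrable f μ ∧ ∫ x, f x ∂μ = (⟪cfc f A v, v⟫_ℂ).re := by
  let L : CompactlySupportedContinuousMap (spectrum ℝ A) ℝ →ₗ[ℝ] ℝ :=
    { toFun := fun f => (⟪cfcHom hA (f : C(spectrum ℝ A, ℝ)) v, v⟫_ℂ).re
      map_add' := fun f g => by
        have : ((f + g : CompactlySupportedContinuousMap (spectrum ℝ A) ℝ) :
          C(spectrum ℝ A, ℝ)) = f + g := rfl
        simp [this]
      map_smul' := fun c f => by
        have : ((c • f : CompactlySupportedContinuousMap (spectrum ℝ A) ℝ) :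
          C(spectrum ℝ A, ℝ)) = c • (f : C(spectrum ℝ A, ℝ)) := rfl
        simp [this] }
  have hL : ∀ f, 0 ≤ f → 0 ≤ L f := by
    intro f hf
    have h0 : 0 ≤ cfcHom hA (f : C(spectrum ℝ A, ℝ)) := by
      rw [cfcHom_nonneg_iff]
      exact fun x => hf x
    rw [ContinuousLinearMap.nonneg_iff_isPositive] at h0
    exact (Complex.nonneg_iff.1 (h0.inner_nonneg_left v)).1
  let Λ := PositiveLinearMap.mk₀ L hL
  let ν := RealRMK.rieszMeasure Λ
  have : IsFiniteMeasure ν := inferInstance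
  refine ⟨ν.map Subtype.val, inferInstance, fun f hf => ?_⟩
  have hemb : MeasurableEmbedding (Subtype.val : spectrum ℝ A → ℝ) :=
    MeasurableEmbedding.subtype_coe (spectrum.isClosed A).measurableSet
  let g : CompactlySupportedContinuousMap (spectrum ℝ A) ℝ :=
    CompactlySupportedContinuousMap.continuousMapEquiv
      ⟨(spectrum ℝ A).domRestrict f, hf.continuousOn.domRestrict⟩
  constructor
  · rw [hemb.integrable_map_iff]
    exact g.integrable
  · rw [hemb.integral_map, cfc_apply f A hA hf.continuousOn]
    exact RealRMK.integral_rieszMeasure Λ g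

theorem spectralDistribution_eq_measureReal {A : H →L[ℂ] H} (hA : IsSelfAdjoint A) (v : H)
    {μ : Measure ℝ} [IsFiniteMeasure μ]
    (hμ : ∀ f : ℝ → ℝ, Continuous f → Integrable f μ ∧ ∫ x, f x ∂μ = (⟪cfc f A v, v⟫_ℂ).re)
    (lam : ℝ) : spectralDistribution A v lam = μ.real (Iic lam) := by
  have h1 : Tendsto (fun n => ∫ x, iicApprox lam n x ∂μ) atTop
      (𝓝 (∫ x, (Iic lam).indicator 1 x ∂μ)) := by
    refine tendsto_integral_of_dominated_convergence (fun _ => 1)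
      (fun n => (continuous_iicApprox lam n).aestronglyMeasurable) (integrable_const _)
      (fun n => ae_of_all _ fun x => ?_) (ae_of_all _ fun x => tendsto_iicApprox lam x)
    have := iicApprox_mem lam n x
    rw [Real.norm_of_nonneg this.1]
    exact this.2
  rw [integral_indicator_one measurableSet_Iic] at h1
  have h2 : Tendsto (fun n => (⟪cfc (iicApprox lam n) A v, v⟫_ℂ).re) atTop
      (𝓝 (spectralDistribution A v lam)) :=
    (Complex.continuous_re.tendsto _).comp
      ((tendsto_cfc_iicApprox hA lam v).inner tendsto_const_nhds)
  refine tendsto_nhds_unique h2 (h1.congr fun n => ?_)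
  exact (hμ _ (continuous_iicApprox lam n)).2

theorem tendsto_measureReal_Iic (μ : Measure ℝ) [IsFiniteMeasure μ] {l : Filter ℝ}
    [l.IsCountablyGenerated] {S : Set ℝ}
    (h : ∀ t, ∀ᶠ y in l, (t ∈ Iic y ↔ t ∈ S)) :
    Tendsto (fun y => μ.real (Iic y)) l (𝓝 (μ.real S)) := by
  have h' := tendsto_measure_of_tendsto_indicator_of_isFiniteMeasure l μ
    (fun y => measurableSet_Iic) h
  exact (ENNReal.tendsto_toReal (measure_ne_top μ S)).comp h'

/-- The nondecreasing right-continuous function `lam ↦ (E(lam) v, v)`. -/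
noncomputable def spectralStieltjes (A : H →L[ℂ] H) (hA : IsSelfAdjoint A) (v : H) :
    StieltjesFunction ℝ where
  toFun := spectralDistribution A v
  mono' := by
    obtain ⟨μ, _, hμ⟩ := exists_measure_cfc hA v
    intro x y hxy
    simp only [spectralDistribution_eq_measureReal hA v hμ]
    exact measureReal_mono (Iic_subset_Iic.2 hxy)
  right_continuous' := by
    obtain ⟨μ, _, hμ⟩ := exists_measure_cfc hA v
    intro x
    have e : spectralDistribution A v = fun lam => μ.real (Iic lam) :=
      funext fun lam => spectralDistribution_eq_measureReal hA v hμ lam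
    rw [e]
    refine (tendsto_measureReal_Iic μ fun t => ?_ : Tendsto _ (𝓝[Ici x] x) _)
    by_cases ht : t ≤ x
    · filter_upwards [self_mem_nhdsWithin] with y hy
      exact ⟨fun _ => ht, fun _ => ht.trans hy⟩
    · push Not at ht
      filter_upwards [mem_nhdsWithin_of_mem_nhds (Iio_mem_nhds ht)] with y hy
      have hy : y < t := hy
      exact ⟨fun h => absurd hy (not_lt.2 h), fun h => absurd ht (not_lt.2 h)⟩

/-- The spectral measure `d(E(lam) v, v)` of a bounded self-adjoint operator `A` at `v`: the
Lebesgue-Stieltjes measure of `lam ↦ (E(lam) v, v)`. -/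
noncomputable def spectralMeasure (A : H →L[ℂ] H) (hA : IsSelfAdjoint A) (v : H) : Measure ℝ :=
  (spectralStieltjes A hA v).measure

theorem eq_spectralMeasure {A : H →L[ℂ] H} (hA : IsSelfAdjoint A) (v : H)
    {μ : Measure ℝ} [IsFiniteMeasure μ]
    (hμ : ∀ f : ℝ → ℝ, Continuous f → Integrable f μ ∧ ∫ x, f x ∂μ = (⟪cfc f A v, v⟫_ℂ).re) :
    μ = spectralMeasure A hA v := by
  have hF : ∀ lam, spectralStieltjes A hA v lam = μ.real (Iic lam) :=
    fun lam => spectralDistribution_eq_measureReal hA v hμ lam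
  have h0 : Tendsto (spectralStieltjes A hA v) atBot (𝓝 0) := by
    have e : (spectralStieltjes A hA v : ℝ → ℝ) = fun lam => μ.real (Iic lam) := funext hF
    rw [e, ← measureReal_empty (μ := μ)]
    refine tendsto_measureReal_Iic μ fun t => ?_
    filter_upwards [Iio_mem_atBot t] with y hy
    simpa using hy
  refine Measure.ext_of_Iic _ _ fun x => ?_
  rw [spectralMeasure, StieltjesFunction.measure_Iic _ h0, sub_zero, hF, ofReal_measureReal]

instance isFiniteMeasure_spectralMeasure (A : H →L[ℂ] H) (hA : IsSelfAdjoint A) (v : H) :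
    IsFiniteMeasure (spectralMeasure A hA v) := by
  obtain ⟨μ, _, hμ⟩ := exists_measure_cfc hA v
  exact eq_spectralMeasure hA v hμ ▸ inferInstance

/-- Spectral theorem: `(f(A) v, v) = ∫ f(x) d(E(x) v, v)` for continuous `f`. -/
theorem integral_spectralMeasure {A : H →L[ℂ] H} (hA : IsSelfAdjoint A) (v : H) {f : ℝ → ℝ}
    (hf : Continuous f) : ∫ x, f x ∂(spectralMeasure A hA v) = (⟪cfc f A v, v⟫_ℂ).re := by
  obtain ⟨μ, _, hμ⟩ := exists_measure_cfc hA v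
  rw [← eq_spectralMeasure hA v hμ]
  exact (hμ f hf).2

end Spectral

/-! The density is recovered from the Turán determinants `D_n = p_{n+1}² - (a_{n+1}/a_n) p_n
p_{n+2}` of the orthonormal polynomials, whose limit is computed in two ways.

Weakly: since `p_n(J) e_0 = e_n`, the integral `∫ f p_{n+i} p_{n+j} dρ` is a matrix element of
`f(J)` far down the diagonal, where `J` looks like the free matrix with off-diagonal `1/2`. It
therefore tends to the cosine coefficient of `f(cos θ)` of index `i - j`
(`tendsto_integral_mul_jacobiPoly`). For `D_n` this gives `D_n dρ → (2/π) √(1 - x²) dx` weakly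
(`tendsto_integral_mul_turan`, `chebyshevCoeff_zero_sub_two`).

Pointwise: by the recurrence, `D_n` is a quadratic form in two consecutive polynomials, with cross
coefficient tending to `2x`, hence positive definite for `|x| < 1` and large `n`. The increment
`D_{n+1} - D_n` is a form in the same pair, with coefficients controlled by the variation of `a` and
`b`. The relative increments are thus summable, and `D_n` converges locally uniformly on `(-1, 1)`
to a continuous positive `D` (`tendstoUniformlyOn_turan`).

Comparing the limits, `D dρ = (2/π) √(1 - x²) dx` on `(-1, 1)`, so `w = 2 √(1 - x²) / (π D)`. -/

/-! ## Orthonormal polynomials -/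

/-- The orthonormal polynomials of a Jacobi matrix, as real functions. -/
noncomputable def jacobiPoly (a b : ℕ → ℝ) : ℕ → ℝ → ℝ
  | 0, _ => 1
  | 1, x => (x - b 0) / a 0
  | n + 2, x => ((x - b (n + 1)) * jacobiPoly a b (n + 1) x - a n * jacobiPoly a b n x) / a (n + 1)

theorem jacobiPoly_add_two (a b : ℕ → ℝ) (n : ℕ) (x : ℝ) : jacobiPoly a b (n + 2) x =
    ((x - b (n + 1)) * jacobiPoly a b (n + 1) x - a n * jacobiPoly a b n x) / a (n + 1) := rfl

theorem mul_jacobiPoly_zero {a b : ℕ → ℝ} (ha : ∀ n, 0 < a n) (x : ℝ) :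
    x * jacobiPoly a b 0 x = b 0 * jacobiPoly a b 0 x + a 0 * jacobiPoly a b 1 x := by
  have := (ha 0).ne'
  simp only [jacobiPoly]
  field_simp
  ring

theorem mul_jacobiPoly_succ {a b : ℕ → ℝ} (ha : ∀ n, 0 < a n) (n : ℕ) (x : ℝ) :
    x * jacobiPoly a b (n + 1) x = a n * jacobiPoly a b n x +
      b (n + 1) * jacobiPoly a b (n + 1) x + a (n + 1) * jacobiPoly a b (n + 2) x := by
  have := (ha (n + 1)).ne'
  rw [jacobiPoly_add_two]
  field_simp
  ring

theorem continuous_jacobiPoly (a b : ℕ → ℝ) (n : ℕ) : Continuous (jacobiPoly a b n) := by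
  induction n using Nat.twoStepInduction with
  | zero => exact continuous_const
  | one => exact (continuous_id.sub continuous_const).div_const _
  | more n h0 h1 =>
    exact (((continuous_id.sub continuous_const).mul h1).sub (continuous_const.mul h0)).div_const _

/-- Two consecutive orthonormal polynomials have no common zero. -/
theorem jacobiPoly_ne_zero {a b : ℕ → ℝ} (ha : ∀ n, 0 < a n) (n : ℕ) (x : ℝ) :
    jacobiPoly a b n x ≠ 0 ∨ jacobiPoly a b (n + 1) x ≠ 0 := by
  induction n with
  | zero => left; simp [jacobiPoly]
  | succ n ih =>
    by_contra! h
    have h1 := mul_jacobiPoly_succ (b := b) ha n x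
    rw [h.1, h.2] at h1
    have h2 : jacobiPoly a b n x = 0 := by
      have := (ha n).ne'
      simpa [this] using h1
    exact ih.elim (fun h' => h' h2) (fun h' => h' h.1)

/-! ### Polynomials in the operator and their integrals against the spectral measure -/

section SpectralMeasure

variable {H : Type*} [NormedAddCommGroup H] [InnerProductSpace ℂ H] [CompleteSpace H]

/-- An orthonormal sequence in which the self-adjoint operator `A` acts as the Jacobi matrix with
diagonal `b` and off-diagonal `a`. -/
structure IsJacobiBasis (a b : ℕ → ℝ) (A : H →L[ℂ] H) (e : ℕ → H) : Prop where
  isSelfAdjoint : IsSelfAdjoint A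
  orthonormal : Orthonormal ℂ e
  apply_zero : A (e 0) = (b 0 : ℂ) • e 0 + (a 0 : ℂ) • e 1
  apply_succ : ∀ n, A (e (n + 1)) =
    (a n : ℂ) • e n + (b (n + 1) : ℂ) • e (n + 1) + (a (n + 1) : ℂ) • e (n + 2)

/-- Both sides satisfy the same three-term recurrence with the same start, and positivity of `a`
lets it be solved for the next vector. -/
theorem cfc_jacobiPoly_apply {a b : ℕ → ℝ} (ha_pos : ∀ n, 0 < a n) {A : H →L[ℂ] H}
    {e : ℕ → H} (hJ : IsJacobiBasis a b A e) (n : ℕ) :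
    cfc (jacobiPoly a b n) A (e 0) = e n := by
  have hA := hJ.isSelfAdjoint
  have hc : ∀ n, ContinuousOn (jacobiPoly a b n) (spectrum ℝ A) :=
    fun n => (continuous_jacobiPoly a b n).continuousOn
  have hsm : ∀ (c : ℝ) (n : ℕ), cfc (fun x => c * jacobiPoly a b n x) A (e 0) =
      (c : ℂ) • cfc (jacobiPoly a b n) A (e 0) := by
    intro c n
    rw [cfc_const_mul c _ A (hc n)]
    simp
  have hcm : ∀ (c : ℝ) (n : ℕ), ContinuousOn (fun x => c * jacobiPoly a b n x) (spectrum ℝ A) :=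
    fun c n => continuousOn_const.mul (hc n)
  have hX : ∀ n, cfc (fun x => x * jacobiPoly a b n x) A (e 0) =
      A (cfc (jacobiPoly a b n) A (e 0)) := by
    intro n
    rw [cfc_mul (fun x => x) _ A continuousOn_id (hc n), cfc_id' ℝ A]
    rfl
  have hcan : ∀ n (u v : H), (a n : ℂ) • u = (a n : ℂ) • v → u = v := by
    intro n u v h
    exact smul_right_injective _ (by exact_mod_cast (ha_pos n).ne') h
  induction n using Nat.twoStepInduction with
  | zero =>
    have : jacobiPoly a b 0 = fun _ => 1 := by funext x; simp [jacobiPoly]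
    rw [this, cfc_const_one ℝ A]
    rfl
  | one =>
    have h0 : cfc (jacobiPoly a b 0) A (e 0) = e 0 := by
      have : jacobiPoly a b 0 = fun _ => 1 := by funext x; simp [jacobiPoly]
      rw [this, cfc_const_one ℝ A]
      rfl
    have h := hX 0
    simp only [mul_jacobiPoly_zero ha_pos] at h
    rw [cfc_add _ _ _ (hcm _ _) (hcm _ _), add_apply, hsm, hsm, h0,
      hJ.apply_zero] at h
    exact hcan 0 _ _ (add_left_cancel h)
  | more n h0 h1 =>
    have h := hX (n + 1)
    simp only [mul_jacobiPoly_succ ha_pos] at h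
    rw [cfc_add A (fun x => a n * jacobiPoly a b n x + b (n + 1) * jacobiPoly a b (n + 1) x)
      (fun x => a (n + 1) * jacobiPoly a b (n + 2) x)
      ((hcm _ _).add (hcm _ _)) (hcm _ _), add_apply,
      cfc_add _ _ _ (hcm _ _) (hcm _ _), add_apply, hsm, hsm, hsm, h0, h1,
      hJ.apply_succ] at h
    exact hcan (n + 1) _ _ (add_left_cancel h)

theorem integrable_spectralMeasure {A : H →L[ℂ] H} (hA : IsSelfAdjoint A) (v : H) {f : ℝ → ℝ}
    (hf : Continuous f) : Integrable f (spectralMeasure A hA v) := by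
  obtain ⟨μ, _, hμ⟩ := exists_measure_cfc hA v
  exact eq_spectralMeasure hA v hμ ▸ (hμ f hf).1

theorem integral_mul_mul_spectralMeasure {A : H →L[ℂ] H} (hA : IsSelfAdjoint A) (v : H)
    {f g h : ℝ → ℝ} (hf : Continuous f) (hg : Continuous g) (hh : Continuous h) :
    ∫ x, f x * g x * h x ∂(spectralMeasure A hA v) = (⟪cfc f A (cfc g A v), cfc h A v⟫_ℂ).re := by
  rw [integral_spectralMeasure hA v (f := fun x => f x * g x * h x) ((hf.mul hg).mul hh)]
  have e : cfc (fun x => f x * g x * h x) A = cfc h A * (cfc f A * cfc g A) := by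
    rw [← cfc_mul f g A hf.continuousOn hg.continuousOn,
      ← cfc_mul h (fun x => f x * g x) A hh.continuousOn (hf.mul hg).continuousOn]
    congr 1
    funext x
    ring
  have hs : IsSelfAdjoint (cfc h A) := cfc_predicate _ A
  rw [e, mul_apply_eq_comp, ← ContinuousLinearMap.adjoint_inner_right, hs.adjoint_eq]
  rfl

theorem integrable_mul_jacobiPoly (a b : ℕ → ℝ) {A : H →L[ℂ] H} (hA : IsSelfAdjoint A) (v : H)
    {f : ℝ → ℝ} (hf : Continuous f) (n m : ℕ) :
    Integrable (fun x => f x * jacobiPoly a b n x * jacobiPoly a b m x)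
      (spectralMeasure A hA v) :=
  integrable_spectralMeasure _ _
    ((hf.mul (continuous_jacobiPoly a b n)).mul (continuous_jacobiPoly a b m))

/-- The bridge from integrals to operator theory: estimates for `f(A)` become estimates uniform in
`n` and `m`. -/
theorem integral_mul_jacobiPoly {a b : ℕ → ℝ} (ha_pos : ∀ n, 0 < a n) {A : H →L[ℂ] H}
    {e : ℕ → H} (hJ : IsJacobiBasis a b A e) {f : ℝ → ℝ} (hf : Continuous f) (n m : ℕ) :
    ∫ x, f x * jacobiPoly a b n x * jacobiPoly a b m x
        ∂(spectralMeasure A hJ.isSelfAdjoint (e 0)) = (⟪cfc f A (e n), e m⟫_ℂ).re := by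
  rw [integral_mul_mul_spectralMeasure _ _ hf (continuous_jacobiPoly a b n)
    (continuous_jacobiPoly a b m), cfc_jacobiPoly_apply ha_pos hJ, cfc_jacobiPoly_apply ha_pos hJ]

theorem integral_jacobiPoly_mul {a b : ℕ → ℝ} (ha_pos : ∀ n, 0 < a n) {A : H →L[ℂ] H}
    {e : ℕ → H} (hJ : IsJacobiBasis a b A e) (n m : ℕ) :
    ∫ x, 1 * jacobiPoly a b n x * jacobiPoly a b m x
        ∂(spectralMeasure A hJ.isSelfAdjoint (e 0)) = if n = m then 1 else 0 := by
  have hA := hJ.isSelfAdjoint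
  rw [integral_mul_jacobiPoly ha_pos hJ (f := fun _ => 1) continuous_const, cfc_const_one ℝ A]
  change (⟪e n, e m⟫_ℂ).re = _
  rw [orthonormal_iff_ite.1 hJ.orthonormal]
  split_ifs <;> simp

/-- The spectrum lies in `[-‖A‖, ‖A‖]`, so `‖f(A)‖ ≤ ε`. Uniformity in `n, m` is what permits
replacing `f` by a polynomial before letting `n → ∞`. -/
theorem abs_integral_mul_jacobiPoly_le {a b : ℕ → ℝ} (ha_pos : ∀ n, 0 < a n) {A : H →L[ℂ] H}
    {e : ℕ → H} (hJ : IsJacobiBasis a b A e) {f : ℝ → ℝ} (hf : Continuous f) {ε : ℝ}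
    (hfε : ∀ x ∈ Icc (-‖A‖) ‖A‖, |f x| ≤ ε) (n m : ℕ) :
    |∫ x, f x * jacobiPoly a b n x * jacobiPoly a b m x
        ∂(spectralMeasure A hJ.isSelfAdjoint (e 0))| ≤ ε := by
  rw [integral_mul_jacobiPoly ha_pos hJ hf]
  have hε : 0 ≤ ε := (abs_nonneg _).trans
    (hfε 0 ⟨neg_nonpos.2 (norm_nonneg A), norm_nonneg A⟩)
  have : Nontrivial H := ⟨e 0, 0, hJ.orthonormal.ne_zero 0⟩
  have h1 : ‖cfc f A‖ ≤ ε := norm_cfc_le hε fun x hx =>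
    hfε x (abs_le.1 (spectrum.norm_le_norm_of_mem hx))
  calc _ ≤ ‖⟪cfc f A (e n), e m⟫_ℂ‖ := Complex.abs_re_le_norm _
    _ ≤ ‖cfc f A (e n)‖ * ‖e m‖ := norm_inner_le_norm _ _
    _ ≤ ε * ‖e n‖ * ‖e m‖ := by
      gcongr
      exact (cfc f A).le_of_opNorm_le h1 _
    _ = ε := by rw [hJ.orthonormal.1, hJ.orthonormal.1]; ring

end SpectralMeasure

/-! ## Weak asymptotics of products of orthonormal polynomials -/

/-- The Fourier cosine coefficient of `θ ↦ f (cos θ)`. -/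
noncomputable def chebyshevCoeff (f : ℝ → ℝ) (k : ℝ) : ℝ :=
  Real.pi⁻¹ * ∫ θ in (0 : ℝ)..Real.pi, f (Real.cos θ) * Real.cos (k * θ)

theorem chebyshevCoeff_one (k : ℤ) :
    chebyshevCoeff (fun _ => 1) k = if k = 0 then 1 else 0 := by
  unfold chebyshevCoeff
  split_ifs with h
  · subst h
    simp [Real.pi_ne_zero]
  · have hk : (k : ℝ) ≠ 0 := by exact_mod_cast h
    simp only [one_mul]
    rw [intervalIntegral.integral_comp_mul_left (fun x => Real.cos x) hk]
    simp [Real.sin_int_mul_pi]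

theorem chebyshevCoeff_add {f g : ℝ → ℝ} (hf : Continuous f) (hg : Continuous g) (k : ℝ) :
    chebyshevCoeff (fun x => f x + g x) k = chebyshevCoeff f k + chebyshevCoeff g k := by
  unfold chebyshevCoeff
  rw [← mul_add, ← intervalIntegral.integral_add]
  · simp only [add_mul]
  all_goals exact Continuous.intervalIntegrable (by fun_prop) _ _

theorem chebyshevCoeff_const_mul (c : ℝ) (f : ℝ → ℝ) (k : ℝ) :
    chebyshevCoeff (fun x => c * f x) k = c * chebyshevCoeff f k := by
  unfold chebyshevCoeff
  simp only [mul_assoc]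
  rw [intervalIntegral.integral_const_mul]
  ring

/-- From `2 cos θ cos kθ = cos (k-1)θ + cos (k+1)θ`: multiplication by `x` acts on the coefficients
as the free Jacobi matrix, the limiting form of the recurrence for `p_n`. -/
theorem chebyshevCoeff_id_mul {f : ℝ → ℝ} (hf : Continuous f) (k : ℝ) :
    chebyshevCoeff (fun x => x * f x) k =
      1 / 2 * chebyshevCoeff f (k - 1) + 1 / 2 * chebyshevCoeff f (k + 1) := by
  unfold chebyshevCoeff
  have : ∀ A B : ℝ, 1 / 2 * (Real.pi⁻¹ * A) + 1 / 2 * (Real.pi⁻¹ * B) =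
    Real.pi⁻¹ * (1 / 2 * (A + B)) := by intros; ring
  rw [this, ← intervalIntegral.integral_add, ← intervalIntegral.integral_const_mul (1 / 2 : ℝ)]
  · congr 1
    refine intervalIntegral.integral_congr fun θ _ => ?_
    beta_reduce
    rw [sub_mul, add_mul, one_mul, Real.cos_sub, Real.cos_add]
    ring
  all_goals exact Continuous.intervalIntegrable (by fun_prop) _ _

theorem abs_chebyshevCoeff_le {f : ℝ → ℝ} {ε : ℝ} (hf : ∀ x ∈ Icc (-1 : ℝ) 1, |f x| ≤ ε) (k : ℝ) :
    |chebyshevCoeff f k| ≤ ε := by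
  have h := intervalIntegral.norm_integral_le_of_norm_le_const (a := 0) (b := Real.pi) (C := ε)
    (f := fun θ => f (Real.cos θ) * Real.cos (k * θ)) (fun θ _ => by
      have h1 := hf _ ⟨Real.neg_one_le_cos θ, Real.cos_le_one θ⟩
      have h2 := Real.abs_cos_le_one (k * θ)
      rw [Real.norm_eq_abs, abs_mul]
      calc _ ≤ ε * 1 := mul_le_mul h1 h2 (abs_nonneg _) ((abs_nonneg _).trans h1)
        _ = ε := mul_one _)
  rw [sub_zero, Real.norm_eq_abs, abs_of_pos Real.pi_pos] at h
  rw [chebyshevCoeff, abs_mul, abs_of_pos (inv_pos.2 Real.pi_pos), inv_mul_le_iff₀ Real.pi_pos]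
  linarith

section Weak

variable {H : Type*} [NormedAddCommGroup H] [InnerProductSpace ℂ H] [CompleteSpace H]

/-- Constants are handled by orthonormality. Each further factor `x` is absorbed into `p_{n+i}` by
the recurrence, whose coefficients tend to `1/2, 0, 1/2`, matching `chebyshevCoeff_id_mul`. -/
theorem tendsto_integral_polynomial_mul_jacobiPoly {a b : ℕ → ℝ} (ha_pos : ∀ n, 0 < a n)
    (ha : Tendsto a atTop (𝓝 (1 / 2))) (hb : Tendsto b atTop (𝓝 0)) {A : H →L[ℂ] H}
    {e : ℕ → H} (hJ : IsJacobiBasis a b A e) (q : Polynomial ℝ) (i j : ℕ) :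
    Tendsto (fun n => ∫ x, q.eval x * jacobiPoly a b (n + i) x * jacobiPoly a b (n + j) x
      ∂(spectralMeasure A hJ.isSelfAdjoint (e 0))) atTop
      (𝓝 (chebyshevCoeff (fun x => q.eval x) ((i - j : ℤ) : ℝ))) := by
  set ρ := spectralMeasure A hJ.isSelfAdjoint (e 0) with hρ
  have hint : ∀ {f : ℝ → ℝ} (_ : Continuous f) (n m : ℕ),
      Integrable (fun x => f x * jacobiPoly a b n x * jacobiPoly a b m x) ρ :=
    fun hf n m => integrable_mul_jacobiPoly a b hJ.isSelfAdjoint (e 0) hf n m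
  induction q using Polynomial.induction_on generalizing i j with
  | C c =>
    simp only [Polynomial.eval_C]
    have h1 := chebyshevCoeff_const_mul c (fun _ => 1) ((i - j : ℤ) : ℝ)
    simp only [mul_one] at h1
    rw [h1, chebyshevCoeff_one]
    refine tendsto_const_nhds.congr fun n => ?_
    have h2 := integral_jacobiPoly_mul ha_pos hJ (n + i) (n + j)
    have h3 : ∀ x, c * jacobiPoly a b (n + i) x * jacobiPoly a b (n + j) x =
      c * (1 * jacobiPoly a b (n + i) x * jacobiPoly a b (n + j) x) := fun x => by ring
    simp only [h3]
    rw [integral_const_mul, h2]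
    congr 1
    refine if_congr ?_ rfl rfl
    omega
  | add p q hp hq =>
    simp only [Polynomial.eval_add]
    rw [chebyshevCoeff_add p.continuous q.continuous]
    refine ((hp i j).add (hq i j)).congr fun n => ?_
    rw [← integral_add (hint p.continuous _ _) (hint q.continuous _ _)]
    simp only [add_mul]
  | monomial k c ih =>
    set f : ℝ → ℝ := fun x => (Polynomial.C c * Polynomial.X ^ k).eval x with hf
    have hfc : Continuous f := Polynomial.continuous _
    change ∀ i j : ℕ, Tendsto (fun n => ∫ x, f x * jacobiPoly a b (n + i) x *
      jacobiPoly a b (n + j) x ∂ρ) atTop (𝓝 (chebyshevCoeff f ((i - j : ℤ) : ℝ))) at ih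
    have e1 : ∀ x, (Polynomial.C c * Polynomial.X ^ (k + 1)).eval x = x * f x := by
      intro x
      simp [hf]
      ring
    simp only [e1]
    -- Shifting `n` by one keeps the lower neighbour `p_{n+i}` within natural indices; the second
    -- index becomes `j + 1`.
    rw [← tendsto_add_atTop_iff_nat 1, chebyshevCoeff_id_mul hfc]
    have h0 := ((ha.comp (tendsto_add_atTop_nat i)).mul (ih i (j + 1))).add
      (((hb.comp (tendsto_add_atTop_nat (i + 1))).mul (ih (i + 1) (j + 1))).add
      ((ha.comp (tendsto_add_atTop_nat (i + 1))).mul (ih (i + 2) (j + 1))))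
    convert h0 using 1
    · funext n
      simp only [Function.comp_apply]
      rw [← integral_const_mul, ← integral_const_mul, ← integral_const_mul, ← integral_add,
        ← integral_add]
      · congr 1
        funext x
        have h1 := mul_jacobiPoly_succ (b := b) ha_pos (n + i) x
        have n1 : n + 1 + i = n + i + 1 := by ring
        have n2 : n + 1 + j = n + (j + 1) := by ring
        rw [n1, n2]
        have e2 : x * f x * jacobiPoly a b (n + i + 1) x * jacobiPoly a b (n + (j + 1)) x =
          f x * (x * jacobiPoly a b (n + i + 1) x) * jacobiPoly a b (n + (j + 1)) x := by ring
        rw [e2, h1]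
        simp only [add_assoc]
        ring
      · exact (hint hfc _ _).const_mul _
      · exact ((hint hfc _ _).const_mul _).add ((hint hfc _ _).const_mul _)
      · exact (hint hfc _ _).const_mul _
      · exact (hint hfc _ _).const_mul _
    · rw [zero_mul, zero_add]
      push_cast
      rw [show (i : ℝ) - j - 1 = i - (j + 1) by ring,
        show (i : ℝ) - j + 1 = i + 2 - (j + 1) by ring]

theorem tendsto_integral_mul_jacobiPoly {a b : ℕ → ℝ} (ha_pos : ∀ n, 0 < a n)
    (ha : Tendsto a atTop (𝓝 (1 / 2))) (hb : Tendsto b atTop (𝓝 0)) {A : H →L[ℂ] H}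
    {e : ℕ → H} (hJ : IsJacobiBasis a b A e) {f : ℝ → ℝ} (hf : Continuous f) (i j : ℕ) :
    Tendsto (fun n => ∫ x, f x * jacobiPoly a b (n + i) x * jacobiPoly a b (n + j) x
      ∂(spectralMeasure A hJ.isSelfAdjoint (e 0))) atTop
      (𝓝 (chebyshevCoeff f ((i - j : ℤ) : ℝ))) := by
  rw [Metric.tendsto_atTop]
  intro ε hε
  -- The interval must contain the spectrum, for the integrals, and `[-1, 1]`, for the limiting
  -- coefficient.
  set R := max 1 ‖A‖ with hR
  obtain ⟨q, hq⟩ := exists_polynomial_near_of_continuousOn (-R) R f hf.continuousOn (ε / 3)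
    (by positivity)
  have hg : Continuous fun x => f x - q.eval x := hf.sub q.continuous
  have hgε : ∀ x ∈ Icc (-R) R, |f x - q.eval x| ≤ ε / 3 := by
    intro x hx
    rw [abs_sub_comm]
    exact (hq x hx).le
  have hsub : ∀ {t : ℝ}, t ≤ R → ∀ x ∈ Icc (-t) t, |f x - q.eval x| ≤ ε / 3 :=
    fun ht x hx => hgε x ⟨(neg_le_neg ht).trans hx.1, hx.2.trans ht⟩
  obtain ⟨N, hN⟩ := Metric.tendsto_atTop.1
    (tendsto_integral_polynomial_mul_jacobiPoly ha_pos ha hb hJ q i j) (ε / 3) (by positivity)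
  refine ⟨N, fun n hn => ?_⟩
  have h1 := hN n hn
  have h2 := abs_integral_mul_jacobiPoly_le ha_pos hJ hg (hsub (le_max_right _ _)) (n + i) (n + j)
  have h3 := abs_chebyshevCoeff_le (hsub (le_max_left _ _)) ((i - j : ℤ) : ℝ)
  have h4 : chebyshevCoeff f ((i - j : ℤ) : ℝ) =
      chebyshevCoeff (fun x => f x - q.eval x) ((i - j : ℤ) : ℝ) +
      chebyshevCoeff (fun x => q.eval x) ((i - j : ℤ) : ℝ) := by
    rw [← chebyshevCoeff_add hg q.continuous]
    simp
  have h5 : ∫ x, f x * jacobiPoly a b (n + i) x * jacobiPoly a b (n + j) x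
        ∂(spectralMeasure A hJ.isSelfAdjoint (e 0)) =
      ∫ x, (f x - q.eval x) * jacobiPoly a b (n + i) x * jacobiPoly a b (n + j) x
        ∂(spectralMeasure A hJ.isSelfAdjoint (e 0)) +
      ∫ x, q.eval x * jacobiPoly a b (n + i) x * jacobiPoly a b (n + j) x
        ∂(spectralMeasure A hJ.isSelfAdjoint (e 0)) := by
    rw [← integral_add (integrable_mul_jacobiPoly a b hJ.isSelfAdjoint (e 0) hg _ _)
      (integrable_mul_jacobiPoly a b hJ.isSelfAdjoint (e 0) q.continuous _ _)]
    congr 1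
    funext x
    ring
  rw [h4, h5]
  rw [Real.dist_eq] at h1 ⊢
  rw [abs_lt] at h1 ⊢
  rw [abs_le] at h2 h3
  constructor <;> linarith [h1.1, h1.2, h2.1, h2.2, h3.1, h3.2]

/-! ## Turán determinants -/

/-- The Turán determinant `p_{n+1}² - (a_{n+1} / a_n) p_n p_{n+2}`. -/
noncomputable def turan (a b : ℕ → ℝ) (n : ℕ) (x : ℝ) : ℝ :=
  jacobiPoly a b (n + 1) x * jacobiPoly a b (n + 1) x -
    a (n + 1) / a n * (jacobiPoly a b n x * jacobiPoly a b (n + 2) x)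

theorem continuous_turan (a b : ℕ → ℝ) (n : ℕ) : Continuous (turan a b n) :=
  ((continuous_jacobiPoly a b _).mul (continuous_jacobiPoly a b _)).sub
    (continuous_const.mul ((continuous_jacobiPoly a b _).mul (continuous_jacobiPoly a b _)))

/-- Eliminating `p_{n+2}` exhibits a form in `(p_n, p_{n+1})` whose cross coefficient tends to `2x`,
hence is definite for `|x| < 1`. -/
theorem turan_eq {a : ℕ → ℝ} (b : ℕ → ℝ) (ha_pos : ∀ n, 0 < a n) (n : ℕ) (x : ℝ) :
    turan a b n x = jacobiPoly a b (n + 1) x ^ 2 + jacobiPoly a b n x ^ 2 -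
      (x - b (n + 1)) / a n * (jacobiPoly a b n x * jacobiPoly a b (n + 1) x) := by
  have h0 := (ha_pos n).ne'
  have h1 := (ha_pos (n + 1)).ne'
  rw [turan, jacobiPoly_add_two]
  field_simp
  ring

/-- Eliminating `p_n` instead expresses `D_n` in the pair `(p_{n+1}, p_{n+2})`, the one in which
`turan_eq` expresses `D_{n+1}`, so that the two can be subtracted. -/
theorem turan_eq' {a : ℕ → ℝ} (b : ℕ → ℝ) (ha_pos : ∀ n, 0 < a n) (n : ℕ) (x : ℝ) :
    turan a b n x = jacobiPoly a b (n + 1) x ^ 2 +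
      (a (n + 1) / a n * jacobiPoly a b (n + 2) x) ^ 2 -
      (x - b (n + 1)) / a n *
        (jacobiPoly a b (n + 1) x * (a (n + 1) / a n * jacobiPoly a b (n + 2) x)) := by
  have h0 := (ha_pos n).ne'
  have h1 := (ha_pos (n + 1)).ne'
  have h2 := mul_jacobiPoly_succ (b := b) ha_pos n x
  have h3 : jacobiPoly a b n x = ((x - b (n + 1)) * jacobiPoly a b (n + 1) x -
      a (n + 1) * jacobiPoly a b (n + 2) x) / a n := by
    field_simp
    linarith
  rw [turan, h3]
  field_simp
  ring

/-- Integrals against Turán determinants converge to integrals against the semicircle weight. -/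
theorem tendsto_integral_mul_turan {a b : ℕ → ℝ} (ha_pos : ∀ n, 0 < a n)
    (ha : Tendsto a atTop (𝓝 (1 / 2))) (hb : Tendsto b atTop (𝓝 0)) {A : H →L[ℂ] H}
    {e : ℕ → H} (hJ : IsJacobiBasis a b A e) {f : ℝ → ℝ} (hf : Continuous f) :
    Tendsto (fun n => ∫ x, f x * turan a b n x ∂(spectralMeasure A hJ.isSelfAdjoint (e 0))) atTop
      (𝓝 (chebyshevCoeff f 0 - chebyshevCoeff f 2)) := by
  have h11 := tendsto_integral_mul_jacobiPoly ha_pos ha hb hJ hf 1 1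
  -- The order `2, 0` makes the limiting coefficient appear with index `2` rather than `-2`.
  have h02 := tendsto_integral_mul_jacobiPoly ha_pos ha hb hJ hf 2 0
  have ht : Tendsto (fun n => a (n + 1) / a n) atTop (𝓝 1) := by
    have := (ha.comp (tendsto_add_atTop_nat 1)).div ha (by norm_num)
    rwa [div_self (by norm_num)] at this
  have h := h11.sub (ht.mul h02)
  norm_num at h
  refine h.congr fun n => ?_
  rw [← integral_const_mul, ← integral_sub]
  · congr 1
    funext x
    simp only [turan]
    ring
  · exact integrable_mul_jacobiPoly a b hJ.isSelfAdjoint (e 0) hf _ _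
  · exact (integrable_mul_jacobiPoly a b hJ.isSelfAdjoint (e 0) hf _ _).const_mul _

/-- Since `1 - cos 2θ = 2 sin² θ`, the substitution `x = cos θ` uses one factor `sin θ` as the
Jacobian and leaves the other as `√(1 - x²)`. -/
theorem chebyshevCoeff_zero_sub_two {f : ℝ → ℝ} (hf : Continuous f) :
    chebyshevCoeff f 0 - chebyshevCoeff f 2 =
      ∫ x in (-1 : ℝ)..1, f x * (2 / Real.pi * √(1 - x ^ 2)) := by
  have h1 := intervalIntegral.integral_comp_mul_deriv (a := 0) (b := Real.pi) (f := Real.cos)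
    (f' := fun θ => -Real.sin θ) (g := fun x => f x * (2 / Real.pi * √(1 - x ^ 2)))
    (fun θ _ => Real.hasDerivAt_cos θ) (by fun_prop) (by fun_prop)
  rw [Real.cos_zero, Real.cos_pi, intervalIntegral.integral_symm (-1), ← neg_eq_iff_eq_neg] at h1
  rw [← h1, ← intervalIntegral.integral_neg, chebyshevCoeff, chebyshevCoeff, ← mul_sub,
    ← intervalIntegral.integral_sub, ← intervalIntegral.integral_const_mul]
  · refine intervalIntegral.integral_congr fun θ hθ => ?_
    rw [uIcc_of_le Real.pi_pos.le] at hθ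
    have h2 : √(1 - Real.cos θ ^ 2) = Real.sin θ := by
      rw [← Real.sin_sq, Real.sqrt_sq (Real.sin_nonneg_of_mem_Icc hθ)]
    simp only [Function.comp_apply, h2, zero_mul, Real.cos_zero]
    rw [Real.cos_two_mul, Real.cos_sq']
    ring
  all_goals exact Continuous.intervalIntegrable (by fun_prop) _ _

end Weak

/-! ## Locally uniform convergence of the Turán determinants -/

/-- Bounding increments by `F n` gives growth by at most `1 + ε n ≤ exp (ε n)`; bounding them by `F
(n + 1)` gives the same control on decay, with no need for `ε n < 1`. Hence `F n` stays within a
factor `exp (∑ ε)` of `F N`, so absolute increments are uniformly summable and the limit cannot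
vanish. -/
theorem tendstoUniformlyOn_of_relative_variation {α : Type*} {F : ℕ → α → ℝ} {S : Set α}
    {ε : ℕ → ℝ} {N : ℕ} {B : ℝ} (hε : Summable ε) (hε0 : ∀ n, 0 ≤ ε n)
    (hB : ∀ x ∈ S, F N x ≤ B) (hpos : ∀ n, N ≤ n → ∀ x ∈ S, 0 < F n x)
    (h1 : ∀ n, N ≤ n → ∀ x ∈ S, |F (n + 1) x - F n x| ≤ ε n * F n x)
    (h2 : ∀ n, N ≤ n → ∀ x ∈ S, |F (n + 1) x - F n x| ≤ ε n * F (n + 1) x) :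
    TendstoUniformlyOn F (fun x => limUnder atTop fun n => F n x) atTop S ∧
      ∀ x ∈ S, 0 < limUnder atTop fun n => F n x := by
  set T := ∑' n, ε n with hT
  have hsum : ∀ n, ∑ k ∈ Finset.range n, ε k ≤ T := fun n => hε.sum_le_tsum _ fun k _ => hε0 k
  have hup : ∀ n, N ≤ n → ∀ x ∈ S, F n x ≤ Real.exp (∑ k ∈ Finset.range n, ε k) * F N x := by
    intro n hn x hx
    induction n, hn using Nat.le_induction with
    | base =>
      have : 1 ≤ Real.exp (∑ k ∈ Finset.range N, ε k) :=
        Real.one_le_exp (Finset.sum_nonneg fun k _ => hε0 k)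
      exact le_mul_of_one_le_left (hpos N le_rfl x hx).le this
    | succ n hn ih =>
      have := (abs_le.1 (h1 n hn x hx)).2
      rw [Finset.sum_range_succ, add_comm (Finset.sum _ _), Real.exp_add, mul_assoc]
      calc F (n + 1) x ≤ (ε n + 1) * F n x := by linarith
        _ ≤ Real.exp (ε n) * F n x :=
          mul_le_mul_of_nonneg_right (Real.add_one_le_exp _) (hpos n hn x hx).le
        _ ≤ _ := mul_le_mul_of_nonneg_left ih (Real.exp_pos _).le
  have hlow : ∀ n, N ≤ n → ∀ x ∈ S, F N x ≤ Real.exp (∑ k ∈ Finset.range n, ε k) * F n x := by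
    intro n hn x hx
    induction n, hn using Nat.le_induction with
    | base =>
      have : 1 ≤ Real.exp (∑ k ∈ Finset.range N, ε k) :=
        Real.one_le_exp (Finset.sum_nonneg fun k _ => hε0 k)
      exact le_mul_of_one_le_left (hpos N le_rfl x hx).le this
    | succ n hn ih =>
      have := (abs_le.1 (h2 n hn x hx)).1
      rw [Finset.sum_range_succ, Real.exp_add, mul_assoc]
      refine ih.trans (mul_le_mul_of_nonneg_left ?_ (Real.exp_pos _).le)
      calc F n x ≤ (ε n + 1) * F (n + 1) x := by linarith
        _ ≤ Real.exp (ε n) * F (n + 1) x :=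
          mul_le_mul_of_nonneg_right (Real.add_one_le_exp _) (hpos (n + 1) (by omega) x hx).le
  have hM : ∀ n, N ≤ n → ∀ x ∈ S, F n x ≤ Real.exp T * B := fun n hn x hx =>
    (hup n hn x hx).trans (mul_le_mul (Real.exp_le_exp.2 (hsum n)) (hB x hx)
      (hpos N le_rfl x hx).le (Real.exp_pos _).le)
  -- A majorant of the increments independent of `x`; its tails give the uniform rate of
  -- convergence.
  set d : ℕ → ℝ := fun n => ε (n + N) * (Real.exp T * B) with hd
  have hdsum : Summable d := ((summable_nat_add_iff N).2 hε).mul_right _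
  have hdist : ∀ x ∈ S, ∀ n, dist (F (n + N) x) (F (n + 1 + N) x) ≤ d n := by
    intro x hx n
    have h := h1 (n + N) (by omega) x hx
    rw [dist_comm, Real.dist_eq, show n + 1 + N = n + N + 1 by ring]
    exact h.trans (mul_le_mul_of_nonneg_left (hM _ (by omega) x hx) (hε0 _))
  have hlim : ∀ x ∈ S, Tendsto (fun n => F n x) atTop (𝓝 (limUnder atTop fun n => F n x)) := by
    intro x hx
    obtain ⟨y, hy⟩ := cauchySeq_tendsto_of_complete
      (cauchySeq_of_dist_le_of_summable d (hdist x hx) hdsum)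
    exact tendsto_nhds_limUnder ⟨y, (tendsto_add_atTop_iff_nat N).1 hy⟩
  constructor
  · rw [Metric.tendstoUniformlyOn_iff]
    intro δ hδ
    have h0 := tendsto_sum_nat_add d
    obtain ⟨n0, hn0⟩ := eventually_atTop.1 (h0.eventually_lt_const hδ)
    filter_upwards [eventually_ge_atTop (n0 + N)] with n hn x hx
    obtain ⟨m, rfl⟩ : ∃ m, n = m + N := ⟨n - N, by omega⟩
    have h := dist_le_tsum_of_dist_le_of_tendsto d (hdist x hx) hdsum
      ((tendsto_add_atTop_iff_nat N).2 (hlim x hx)) m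
    rw [dist_comm]
    refine h.trans_lt ?_
    simpa [add_comm] using hn0 m (by omega)
  · intro x hx
    have h : Real.exp (-T) * F N x ≤ limUnder atTop fun n => F n x := by
      refine ge_of_tendsto (hlim x hx) ?_
      filter_upwards [eventually_ge_atTop N] with n hn
      rw [Real.exp_neg, inv_mul_le_iff₀ (Real.exp_pos _)]
      exact (hlow n hn x hx).trans (mul_le_mul_of_nonneg_right (Real.exp_le_exp.2 (hsum n))
        (hpos n hn x hx).le)
    exact (mul_pos (Real.exp_pos _) (hpos N le_rfl x hx)).trans_le h

/-- As `|u v| ≤ (u² + v²) / 2`, the cross term costs at most the fraction `(1 + r) / 2` of `u² +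
v²`. -/
theorem quadratic_lower_bound {s r u v : ℝ} (hs : |s| ≤ 1 + r) :
    (1 - r) / 2 * (u ^ 2 + v ^ 2) ≤ u ^ 2 + v ^ 2 - s * (u * v) := by
  have h1 : s * (u * v) ≤ (1 + r) * |u * v| :=
    (le_abs_self _).trans (by rw [abs_mul]; gcongr)
  have h2 : |u * v| ≤ (u ^ 2 + v ^ 2) / 2 := by
    rw [abs_mul]
    nlinarith [sq_nonneg (|u| - |v|), sq_abs u, sq_abs v]
  have h3 : 0 ≤ 1 + r := (abs_nonneg s).trans hs
  nlinarith [mul_le_mul_of_nonneg_left h2 h3]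

/-- In the common pair `(p_{n+1}, p_{n+2})` the squares of `p_{n+1}` cancel, and the other
coefficients vanish when `a` and `b` do not change. The constant is not sharp. -/
theorem abs_turan_succ_sub_le {a b : ℕ → ℝ} (ha_pos : ∀ n, 0 < a n) {n : ℕ}
    (h0 : 1 / 4 ≤ a n) (h0' : a n ≤ 1) (h1 : 1 / 4 ≤ a (n + 1)) (h1' : a (n + 1) ≤ 1)
    (hb : |b (n + 2)| ≤ 1) {x : ℝ} (hx : |x| ≤ 1) :
    |turan a b (n + 1) x - turan a b n x| ≤
      512 * (|a (n + 1) - a n| + |b (n + 2) - b (n + 1)|) *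
        (jacobiPoly a b (n + 1) x ^ 2 + jacobiPoly a b (n + 2) x ^ 2) := by
  rw [turan_eq b ha_pos (n + 1), turan_eq' b ha_pos n]
  simp only [show n + 1 + 1 = n + 2 from rfl]
  generalize jacobiPoly a b (n + 1) x = u
  generalize jacobiPoly a b (n + 2) x = v
  have p0 := ha_pos n
  have p1 := ha_pos (n + 1)
  generalize a n = α at *
  generalize a (n + 1) = β at *
  generalize b (n + 1) = c at *
  generalize b (n + 2) = d at *
  set δ := |β - α| + |d - c| with hδ
  have hδ0 : 0 ≤ δ := by positivity
  have e : v ^ 2 + u ^ 2 - (x - d) / β * (u * v) -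
      (u ^ 2 + (β / α * v) ^ 2 - (x - c) / α * (u * (β / α * v))) =
      ((α - β) * (α + β)) / α ^ 2 * v ^ 2 +
      ((x - d) * (β + α) * (β - α) + (d - c) * β ^ 2) / (α ^ 2 * β) * (u * v) := by
    field_simp
    ring
  rw [e]
  have k1 : |((α - β) * (α + β)) / α ^ 2| ≤ 32 * δ := by
    rw [abs_div, abs_mul, abs_of_pos (show 0 < α + β by linarith),
      abs_of_pos (show 0 < α ^ 2 by positivity), div_le_iff₀ (by positivity)]
    have : (1 : ℝ) / 16 ≤ α ^ 2 := by nlinarith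
    have h2 : |α - β| ≤ δ := by rw [abs_sub_comm]; linarith [abs_nonneg (d - c)]
    calc |α - β| * (α + β) ≤ δ * 2 := by gcongr; linarith
      _ = 32 * δ * (1 / 16) := by ring
      _ ≤ 32 * δ * α ^ 2 := by gcongr
  -- The numerator is at most `4 δ` and the denominator at least `1 / 64`.
  have k2 : |((x - d) * (β + α) * (β - α) + (d - c) * β ^ 2) / (α ^ 2 * β)| ≤ 256 * δ := by
    rw [abs_div, abs_of_pos (show 0 < α ^ 2 * β by positivity), div_le_iff₀ (by positivity)]
    have q1 : (1 : ℝ) / 64 ≤ α ^ 2 * β := by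
      have : (1 : ℝ) / 16 ≤ α ^ 2 := by nlinarith
      calc (1 : ℝ) / 64 = 1 / 16 * (1 / 4) := by norm_num
        _ ≤ α ^ 2 * β := by gcongr
    have q2 : |x - d| ≤ 2 := by
      calc _ ≤ |x| + |d| := abs_sub _ _
        _ ≤ 2 := by linarith
    have q3 : β ^ 2 ≤ 1 := by nlinarith
    calc _ ≤ |(x - d) * (β + α) * (β - α)| + |(d - c) * β ^ 2| := abs_add_le _ _
      _ = |x - d| * (β + α) * |β - α| + |d - c| * β ^ 2 := by
        rw [abs_mul, abs_mul, abs_mul, abs_of_pos (show 0 < β + α by linarith),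
          abs_of_pos (show 0 < β ^ 2 by positivity)]
      _ ≤ 2 * 2 * |β - α| + |d - c| * 1 := by gcongr; linarith
      _ ≤ 4 * δ := by rw [hδ]; linarith [abs_nonneg (d - c)]
      _ = 256 * δ * (1 / 64) := by ring
      _ ≤ 256 * δ * (α ^ 2 * β) := by gcongr
  have k3 : |u * v| ≤ (u ^ 2 + v ^ 2) / 2 := by
    rw [abs_mul]
    nlinarith [sq_nonneg (|u| - |v|), sq_abs u, sq_abs v]
  calc _ ≤ _ := abs_add_le _ _
    _ ≤ 32 * δ * v ^ 2 + 256 * δ * ((u ^ 2 + v ^ 2) / 2) := by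
      rw [abs_mul, abs_mul, abs_of_nonneg (sq_nonneg v)]
      gcongr
    _ ≤ _ := by nlinarith [mul_nonneg hδ0 (sq_nonneg u), mul_nonneg hδ0 (sq_nonneg v)]

/-- The limit of the Turán determinants. -/
noncomputable def turanLimit (a b : ℕ → ℝ) (x : ℝ) : ℝ := limUnder atTop fun n => turan a b n x

/-- On `[-r, r]` the forms are uniformly definite for large `n`, so both `D_n` and `D_{n+1}`
dominate `p_{n+1}² + p_{n+2}²`, which in turn controls their difference; these are the two relative
bounds required. -/
theorem tendstoUniformlyOn_turan {a b : ℕ → ℝ} (ha_pos : ∀ n, 0 < a n)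
    (ha : Tendsto a atTop (𝓝 (1 / 2))) (hb : Tendsto b atTop (𝓝 0))
    (hvar : Summable fun n => |a (n + 1) - a n| + |b (n + 1) - b n|) {r : ℝ}
    (hr : r < 1) :
    TendstoUniformlyOn (turan a b) (turanLimit a b) atTop (Icc (-r) r) ∧
      ∀ x ∈ Icc (-r) r, 0 < turanLimit a b x := by
  have hb1 := hb.comp (tendsto_add_atTop_nat 1)
  have hb2 := hb.comp (tendsto_add_atTop_nat 2)
  have hs : Tendsto (fun n => (r + |b (n + 1)|) / a n) atTop (𝓝 (2 * r)) := by
    have := (hb1.abs.const_add r).div ha (by norm_num)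
    rwa [abs_zero, show (r + 0) / (1 / 2) = 2 * r by ring] at this
  -- The last condition is available because the limit `2 r` is strictly below `1 + r`, itself below
  -- the critical value `2`.
  obtain ⟨N, hN⟩ := eventually_atTop.1 ((ha.eventually_const_le (by norm_num : (1 / 4 : ℝ) < _)).and
    ((ha.eventually_le_const (by norm_num : _ < (1 : ℝ))).and
    ((hb2.abs.eventually_le_const (by norm_num : _ < (1 : ℝ))).and
    (hs.eventually_le_const (by linarith : _ < 1 + r)))))
  have hsx : ∀ n, N ≤ n → ∀ x ∈ Icc (-r) r, |(x - b (n + 1)) / a n| ≤ 1 + r := by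
    intro n hn x hx
    refine le_trans ?_ (hN n hn).2.2.2
    rw [abs_div, abs_of_pos (ha_pos n)]
    have := ha_pos n
    gcongr
    exact (abs_sub _ _).trans (by linarith [abs_le.2 hx])
  have hlow : ∀ n, N ≤ n → ∀ x ∈ Icc (-r) r, (1 - r) / 2 *
      (jacobiPoly a b (n + 1) x ^ 2 + jacobiPoly a b n x ^ 2) ≤ turan a b n x := by
    intro n hn x hx
    rw [turan_eq b ha_pos, mul_comm (jacobiPoly a b n x)]
    exact quadratic_lower_bound (hsx n hn x hx)
  -- The factor `1/32` is `1/2` from the definite form times `1/16` from the square of `a_{n+1} /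
  -- a_n ≥ 1/4`.
  have hlow' : ∀ n, N ≤ n → ∀ x ∈ Icc (-r) r, (1 - r) / 32 *
      (jacobiPoly a b (n + 1) x ^ 2 + jacobiPoly a b (n + 2) x ^ 2) ≤ turan a b n x := by
    intro n hn x hx
    rw [turan_eq' b ha_pos]
    refine le_trans ?_ (quadratic_lower_bound (hsx n hn x hx))
    have ht : 1 / 4 ≤ a (n + 1) / a n := by
      rw [le_div_iff₀ (ha_pos n)]
      linarith [(hN n hn).2.1, (hN (n + 1) (by omega)).1]
    have ht2 : 1 / 16 ≤ (a (n + 1) / a n) ^ 2 := by nlinarith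
    rw [mul_pow]
    have h3 := mul_le_mul_of_nonneg_right ht2 (sq_nonneg (jacobiPoly a b (n + 2) x))
    have : 0 < 1 - r := by linarith
    have h4 : (1 / 16 : ℝ) * (jacobiPoly a b (n + 1) x ^ 2 + jacobiPoly a b (n + 2) x ^ 2) ≤
        jacobiPoly a b (n + 1) x ^ 2 +
          (a (n + 1) / a n) ^ 2 * jacobiPoly a b (n + 2) x ^ 2 := by
      linarith [sq_nonneg (jacobiPoly a b (n + 1) x)]
    calc _ = (1 - r) / 2 * (1 / 16 *
        (jacobiPoly a b (n + 1) x ^ 2 + jacobiPoly a b (n + 2) x ^ 2)) := by ring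
      _ ≤ _ := by gcongr
  have hpos : ∀ n, N ≤ n → ∀ x ∈ Icc (-r) r, 0 < turan a b n x := by
    intro n hn x hx
    refine lt_of_lt_of_le (mul_pos (by linarith) ?_) (hlow n hn x hx)
    rcases jacobiPoly_ne_zero (b := b) ha_pos n x with h | h <;> positivity
  -- Here `16384 = 512 * 32` combines the increment bound with the lower bound `hlow'`.
  set ε : ℕ → ℝ := fun n => 16384 / (1 - r) * (|a (n + 1) - a n| + |b (n + 2) - b (n + 1)|) with hε
  have hεs : Summable ε := by
    refine Summable.mul_left _ (Summable.add ?_ ?_)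
    · exact hvar.of_nonneg_of_le (fun _ => abs_nonneg _) fun n => by
        linarith [abs_nonneg (b (n + 1) - b n)]
    · refine (summable_nat_add_iff (f := fun n => |b (n + 1) - b n|) 1).2 ?_
      exact hvar.of_nonneg_of_le (fun _ => abs_nonneg _) fun n => by
        linarith [abs_nonneg (a (n + 1) - a n)]
  have hr1 : 0 < 1 - r := by linarith
  have hdiff : ∀ n, N ≤ n → ∀ x ∈ Icc (-r) r, |turan a b (n + 1) x - turan a b n x| ≤
      ε n * ((1 - r) / 32 *
        (jacobiPoly a b (n + 1) x ^ 2 + jacobiPoly a b (n + 2) x ^ 2)) := by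
    intro n hn x hx
    obtain ⟨k1, k2, k3, -⟩ := hN n hn
    obtain ⟨l1, l2, -, -⟩ := hN (n + 1) (by omega)
    refine (abs_turan_succ_sub_le ha_pos k1 k2 l1 l2 k3 ((abs_le.2 hx).trans hr.le)).trans_eq ?_
    rw [hε]
    field_simp
    ring
  have hε0 : ∀ n, 0 ≤ ε n := fun n => by positivity
  obtain ⟨B, hB⟩ := (isCompact_Icc (a := -r) (b := r)).bddAbove_image
    (continuous_turan a b N).continuousOn
  refine tendstoUniformlyOn_of_relative_variation hεs hε0
    (fun x hx => hB (mem_image_of_mem _ hx)) hpos (fun n hn x hx => ?_) fun n hn x hx => ?_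
  · exact (hdiff n hn x hx).trans (mul_le_mul_of_nonneg_left (hlow' n hn x hx) (hε0 n))
  · refine (hdiff n hn x hx).trans (mul_le_mul_of_nonneg_left ?_ (hε0 n))
    refine le_trans ?_ (hlow (n + 1) (by omega) x hx)
    rw [add_comm (jacobiPoly a b (n + 1) x ^ 2)]
    gcongr
    norm_num

theorem continuousOn_turanLimit {a b : ℕ → ℝ} (ha_pos : ∀ n, 0 < a n)
    (ha : Tendsto a atTop (𝓝 (1 / 2))) (hb : Tendsto b atTop (𝓝 0))
    (hvar : Summable fun n => |a (n + 1) - a n| + |b (n + 1) - b n|) :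
    ContinuousOn (turanLimit a b) (Ioo (-1) 1) := by
  intro x hx
  obtain ⟨r, hxr, hr⟩ := exists_between (abs_lt.2 hx)
  have h := (tendstoUniformlyOn_turan ha_pos ha hb hvar hr).1
  have hc := h.continuousOn
    (Eventually.of_forall fun n => (continuous_turan a b n).continuousOn).frequently
  obtain ⟨h1, h2⟩ := abs_lt.1 hxr
  exact (hc.continuousAt (Icc_mem_nhds h1 h2)).continuousWithinAt

/-! ## Identification of the spectral measure -/

/-- If `∫ f D dρ = ∫ f s dx` for all continuous `f` supported in a compact subinterval of `(-1, 1)`,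
then `dρ = (s / D) dx` on `(-1, 1)`. -/
theorem restrict_eq_withDensity_div {ρ : Measure ℝ} [IsFiniteMeasure ρ] {D s : ℝ → ℝ}
    (hDc : ContinuousOn D (Ioo (-1) 1)) (hDpos : ∀ x ∈ Ioo (-1 : ℝ) 1, 0 < D x)
    (hsc : Continuous s) (hs0 : ∀ x, 0 ≤ s x)
    (h : ∀ r, 0 ≤ r → r < 1 → ∀ f : ℝ → ℝ, Continuous f → (∀ x ∉ Ioo (-r) r, f x = 0) →
      ∫ x, f x * D x ∂ρ = ∫ x, f x * s x) :
    ρ.restrict (Ioo (-1) 1) =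
      (volume.restrict (Ioo (-1) 1)).withDensity (fun x => ENNReal.ofReal (s x / D x)) := by
  have key : ∀ r : ℝ, 0 ≤ r → r < 1 → ρ.restrict (Ioo (-r) r) =
      (volume.restrict (Ioo (-r) r)).withDensity (fun x => ENNReal.ofReal (s x / D x)) := by
    intro r hr0 hr
    set J := Ioo (-r) r with hJ
    have hJm : MeasurableSet J := measurableSet_Ioo
    have hKI : Icc (-r) r ⊆ Ioo (-1) 1 := fun x hx => ⟨by linarith [hx.1], by linarith [hx.2]⟩
    have hJK : J ⊆ Icc (-r) r := Ioo_subset_Icc_self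
    -- A cutoff positive on `J` and zero outside: `f φ` is an admissible test function for every
    -- bounded continuous `f`, and `φ` can be divided out on `J`.
    set φ : ℝ → ℝ := fun x => max (r - |x|) 0 with hφ
    have hφc : Continuous φ := by fun_prop
    have hφ0 : ∀ x, 0 ≤ φ x := fun x => le_max_right _ _
    have hφpos : ∀ x ∈ J, 0 < φ x := fun x hx =>
      lt_max_of_lt_left (sub_pos.2 (abs_lt.2 hx))
    have hφz : ∀ x ∉ J, φ x = 0 := fun x hx =>
      max_eq_right (sub_nonpos.2 (not_lt.1 fun hlt => hx (abs_lt.1 hlt)))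
    have hφD : ContinuousOn (fun x => φ x * D x) (Icc (-r) r) :=
      hφc.continuousOn.mul (hDc.mono hKI)
    have hφDm : ∀ μ : Measure ℝ, AEMeasurable (fun x => ENNReal.ofReal (φ x * D x))
        (μ.restrict J) := fun μ => ((hφD.mono hJK).aemeasurable hJm).ennreal_ofReal
    have hφsm : Measurable fun x => ENNReal.ofReal (φ x * s x) :=
      (hφc.mul hsc).measurable.ennreal_ofReal
    have hφDpos : ∀ x ∈ J, 0 < φ x * D x := fun x hx =>
      mul_pos (hφpos x hx) (hDpos x (hKI (hJK hx)))
    have hi1 : Integrable (fun x => φ x * D x) (ρ.restrict J) :=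
      (hφD.integrableOn_compact isCompact_Icc).mono_set hJK
    have hi2 : Integrable (fun x => φ x * s x) (volume.restrict J) :=
      ((hφc.mul hsc).continuousOn.integrableOn_compact isCompact_Icc).mono_set hJK
    have := isFiniteMeasure_withDensity_ofReal hi1.2
    have := isFiniteMeasure_withDensity_ofReal hi2.2
    have heq : (ρ.restrict J).withDensity (fun x => ENNReal.ofReal (φ x * D x)) =
        (volume.restrict J).withDensity (fun x => ENNReal.ofReal (φ x * s x)) := by
      refine ext_of_forall_integral_eq_of_IsFiniteMeasure fun f => ?_
      rw [integral_withDensity_eq_integral_toReal_smul₀ (hφDm ρ)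
          (ae_of_all _ fun _ => ENNReal.ofReal_lt_top),
        integral_withDensity_eq_integral_toReal_smul₀ hφsm.aemeasurable
          (ae_of_all _ fun _ => ENNReal.ofReal_lt_top)]
      have e1 : ∫ x in J, (ENNReal.ofReal (φ x * D x)).toReal • f x ∂ρ =
          ∫ x in J, f x * φ x * D x ∂ρ := by
        refine setIntegral_congr_fun hJm fun x hx => ?_
        simp only [ENNReal.toReal_ofReal (hφDpos x hx).le, smul_eq_mul]
        ring
      have e2 : ∫ x in J, (ENNReal.ofReal (φ x * s x)).toReal • f x =
          ∫ x in J, f x * φ x * s x := by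
        refine setIntegral_congr_fun hJm fun x hx => ?_
        simp only [ENNReal.toReal_ofReal (mul_nonneg (hφ0 x) (hs0 x)), smul_eq_mul]
        ring
      rw [e1, e2, setIntegral_eq_integral_of_forall_compl_eq_zero fun x hx => by simp [hφz x hx],
        setIntegral_eq_integral_of_forall_compl_eq_zero fun x hx => by simp [hφz x hx]]
      exact h r hr0 hr (fun x => f x * φ x) (f.continuous.mul hφc)
        fun x hx => by simp [hφz x hx]
    -- The density `φ D` is positive on `J`, so multiplying by its inverse recovers `ρ` from the
    -- identity just proved.
    have hinv := withDensity_inv_same₀ (hφDm ρ)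
      ((ae_restrict_iff' hJm).2 (ae_of_all _ fun x hx => (ENNReal.ofReal_pos.2 (hφDpos x hx)).ne'))
      (ae_of_all _ fun _ => ENNReal.ofReal_ne_top)
    rw [← hinv, heq]
    refine (withDensity_mul₀ hφsm.aemeasurable (hφDm volume).inv).symm.trans ?_
    refine withDensity_congr_ae ((ae_restrict_iff' hJm).2 (ae_of_all _ fun x hx => ?_))
    have h1 := hφpos x hx
    have h2 := hDpos x (hKI (hJK hx))
    rw [Pi.mul_apply, Pi.inv_apply, ← ENNReal.ofReal_inv_of_pos (hφDpos x hx),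
      ← ENNReal.ofReal_mul (mul_nonneg (hφ0 x) (hs0 x))]
    congr 1
    field_simp
  -- Countable exhaustion of `(-1, 1)`; for `n = 0` the interval is empty, covered by allowing `r =
  -- 0`.
  have hU : Ioo (-1 : ℝ) 1 = ⋃ n : ℕ, Ioo (-(1 - 1 / ((n : ℝ) + 1))) (1 - 1 / ((n : ℝ) + 1)) := by
    ext x
    simp only [mem_iUnion]
    constructor
    · intro hx
      obtain ⟨n, hn⟩ := exists_nat_one_div_lt (sub_pos.2 (abs_lt.2 hx))
      exact ⟨n, abs_lt.1 (by linarith)⟩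
    · rintro ⟨n, hn⟩
      have : 0 < 1 / ((n : ℝ) + 1) := by positivity
      exact ⟨by linarith [hn.1], by linarith [hn.2]⟩
  have hsub : ∀ n : ℕ, Ioo (-(1 - 1 / ((n : ℝ) + 1))) (1 - 1 / ((n : ℝ) + 1)) ⊆ Ioo (-1) 1 :=
    fun n => hU ▸ subset_iUnion (fun n : ℕ => Ioo (-(1 - 1 / ((n : ℝ) + 1)))
      (1 - 1 / ((n : ℝ) + 1))) n
  rw [← restrict_withDensity measurableSet_Ioo, hU, Measure.restrict_iUnion_congr]
  intro n
  rw [restrict_withDensity measurableSet_Ioo]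
  have h0 : 0 < 1 / ((n : ℝ) + 1) := by positivity
  have h1 : 1 / ((n : ℝ) + 1) ≤ 1 := by
    rw [div_le_one (by positivity)]
    linarith [n.cast_nonneg (α := ℝ)]
  exact key _ (by linarith) (by linarith)

section Main

variable {H : Type*} [NormedAddCommGroup H] [InnerProductSpace ℂ H] [CompleteSpace H]

/-- The weak limit and the uniform limit of `D_n` must agree on test functions vanishing off `(-r,
r)`, where uniform convergence justifies passing to the limit under the integral. -/
theorem integral_mul_turanLimit {a b : ℕ → ℝ} (ha_pos : ∀ n, 0 < a n)
    (ha : Tendsto a atTop (𝓝 (1 / 2))) (hb : Tendsto b atTop (𝓝 0))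
    (hvar : Summable fun n => |a (n + 1) - a n| + |b (n + 1) - b n|) {A : H →L[ℂ] H}
    {e : ℕ → H} (hJ : IsJacobiBasis a b A e) {r : ℝ} (hr0 : 0 ≤ r) (hr : r < 1) {f : ℝ → ℝ}
    (hf : Continuous f) (hfr : ∀ x ∉ Ioo (-r) r, f x = 0) :
    ∫ x, f x * turanLimit a b x ∂(spectralMeasure A hJ.isSelfAdjoint (e 0)) =
      ∫ x, f x * (2 / Real.pi * √(1 - x ^ 2)) := by
  have hu := (tendstoUniformlyOn_turan ha_pos ha hb hvar hr).1
  have hKI : Icc (-r) r ⊆ Ioo (-1) 1 := fun x hx => ⟨by linarith [hx.1], by linarith [hx.2]⟩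
  have hDc := (continuousOn_turanLimit ha_pos ha hb hvar).mono hKI
  have hout : ∀ x ∉ Icc (-r) r, f x = 0 := fun x hx => hfr x fun h => hx (Ioo_subset_Icc_self h)
  -- Uniform convergence gives `|D_n| ≤ |D| + 1` on `[-r, r]` eventually, so `C` dominates the
  -- integrands.
  obtain ⟨C, hC⟩ := (isCompact_Icc (a := -r) (b := r)).exists_bound_of_continuousOn
    (f := fun x => |f x| * (|turanLimit a b x| + 1))
    (hf.abs.continuousOn.mul (hDc.abs.add continuousOn_const))
  have hC0 : 0 ≤ C := (norm_nonneg _).trans (hC 0 ⟨neg_nonpos.2 hr0, hr0⟩)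
  have hlim : Tendsto (fun n => ∫ x, f x * turan a b n x
      ∂(spectralMeasure A hJ.isSelfAdjoint (e 0))) atTop
      (𝓝 (∫ x, f x * turanLimit a b x ∂(spectralMeasure A hJ.isSelfAdjoint (e 0)))) := by
    refine tendsto_integral_filter_of_dominated_convergence (fun _ => C)
      (Eventually.of_forall fun n => (hf.mul (continuous_turan a b n)).aestronglyMeasurable)
      ?_ (integrable_const _) (ae_of_all _ fun x => ?_)
    · filter_upwards [Metric.tendstoUniformlyOn_iff.1 hu 1 one_pos] with n hn
      refine ae_of_all _ fun x => ?_
      by_cases hx : x ∈ Icc (-r) r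
      · refine le_trans ?_ ((le_abs_self _).trans (hC x hx))
        rw [norm_mul, Real.norm_eq_abs, Real.norm_eq_abs]
        have h1 := hn x hx
        rw [dist_comm, Real.dist_eq] at h1
        have h2 := abs_sub_abs_le_abs_sub (turan a b n x) (turanLimit a b x)
        gcongr
        linarith
      · simpa [hout x hx] using hC0
    · by_cases hx : x ∈ Icc (-r) r
      · exact (hu.tendsto_at hx).const_mul _
      · simp [hout x hx]
  have h := tendsto_nhds_unique hlim (tendsto_integral_mul_turan ha_pos ha hb hJ hf)
  rw [h, chebyshevCoeff_zero_sub_two hf, intervalIntegral.integral_of_le (by norm_num)]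
  refine setIntegral_eq_integral_of_forall_compl_eq_zero fun x hx => ?_
  rw [hfr x fun h => hx (Ioo_subset_Ioc_self (hKI (Ioo_subset_Icc_self h))), zero_mul]

theorem exists_continuous_pos_density {a b : ℕ → ℝ} (ha_pos : ∀ n, 0 < a n)
    (ha : Tendsto a atTop (𝓝 (1 / 2))) (hb : Tendsto b atTop (𝓝 0))
    (hvar : Summable fun n => |a (n + 1) - a n| + |b (n + 1) - b n|) {A : H →L[ℂ] H}
    {e : ℕ → H} (hJ : IsJacobiBasis a b A e) :
    ∃ w : ℝ → ℝ, ContinuousOn w (Ioo (-1) 1) ∧ (∀ x ∈ Ioo (-1 : ℝ) 1, 0 < w x) ∧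
      (spectralMeasure A hJ.isSelfAdjoint (e 0)).restrict (Ioo (-1) 1) =
        (volume.restrict (Ioo (-1) 1)).withDensity (fun x => ENNReal.ofReal (w x)) := by
  have hDc := continuousOn_turanLimit ha_pos ha hb hvar
  have hDpos : ∀ x ∈ Ioo (-1 : ℝ) 1, 0 < turanLimit a b x := fun x hx =>
    -- Positivity at `x` is read off from the interval with `r = |x| < 1`, which has `x` as an
    -- endpoint.
    (tendstoUniformlyOn_turan ha_pos ha hb hvar (abs_lt.2 hx)).2 x
      (abs_le.1 le_rfl)
  have hsc : Continuous fun x : ℝ => 2 / Real.pi * √(1 - x ^ 2) := by fun_prop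
  refine ⟨fun x => 2 / Real.pi * √(1 - x ^ 2) / turanLimit a b x,
    hsc.continuousOn.div hDc fun x hx => (hDpos x hx).ne', fun x hx => ?_, ?_⟩
  · have h1 : 0 < √(1 - x ^ 2) := Real.sqrt_pos.2 (by nlinarith [hx.1, hx.2])
    have h2 := hDpos x hx
    have := Real.pi_pos
    positivity
  · exact restrict_eq_withDensity_div hDc hDpos hsc (fun x => by positivity)
      fun r hr0 hr f hf hfr => integral_mul_turanLimit ha_pos ha hb hvar hJ hr0 hr hf hfr

end Main

/-! ### Specialization to the Jacobi operator in `ℓ²(ℤ₊)` -/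

theorem orthonormal_basisVec : Orthonormal ℂ basisVec := by
  rw [orthonormal_iff_ite]
  intro n m
  rw [inner_basisVec, basisVec_apply]

theorem isJacobiBasis_basisVec (a b : ℕ → ℝ) (ha : ∃ C, ∀ n, |a n| ≤ C)
    (hb : ∃ C, ∀ n, |b n| ≤ C) : IsJacobiBasis a b (jacobiOperator a b ha hb) basisVec where
  isSelfAdjoint := jacobiOperator_isSelfAdjoint a b ha hb
  orthonormal := orthonormal_basisVec
  apply_zero := jacobiOperator_basisVec_zero a b ha hb
  apply_succ := jacobiOperator_basisVec_succ a b ha hb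

theorem theorem5p7 (a b : ℕ → ℝ) (ha_pos : ∀ n, 0 < a n)
    (ha : ∃ C, ∀ n, |a n| ≤ C) (hb : ∃ C, ∀ n, |b n| ≤ C)
    (ha_lim : Tendsto (fun n => a n - 1 / 2) atTop (𝓝 0))
    (hb_lim : Tendsto b atTop (𝓝 0))
    (hvar : Summable fun n => |a (n + 1) - a n| + |b (n + 1) - b n|) :
    ∃ w : ℝ → ℝ, ContinuousOn w (Ioo (-1) 1) ∧ (∀ x ∈ Ioo (-1 : ℝ) 1, 0 < w x) ∧
      (spectralMeasure (jacobiOperator a b ha hb) (jacobiOperator_isSelfAdjoint a b ha hb)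
          (basisVec 0)).restrict (Ioo (-1) 1) =
        (volume.restrict (Ioo (-1) 1)).withDensity (fun x => ENNReal.ofReal (w x)) := by
  have ha' : Tendsto a atTop (𝓝 (1 / 2)) := tendsto_sub_nhds_zero_iff.1 ha_lim
  exact exists_continuous_pos_density ha_pos ha' hb_lim hvar (isJacobiBasis_basisVec a b ha hb)
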